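/- Let $\mathcal H_1,\mathcal H_2$ be finite-dimensional real Hilbert spaces, $Q\colon\mathcal H_1\to\mathcal H_1$ a monotone (positive semidefinite) self-adjoint linear operator, $q\in\mathcal H_1$, $A\colon\mathcal H_1\to\mathcal H_2$ a linear operator, and $\mathcal B\subseteq\mathcal H_1$, $\mathcal C\subseteq\mathcal H_2$ nonempty closed convex sets. On the Hilbert space $\mathcal H=\mathcal H_1\times\mathcal H_2$, with $\|(z,y)\|^2=\|z\|^2+\|y\|^2$, put $$f(z,y)=\iota_{\mathcal B}(z)+\iota_{\mathcal C}(y),\qquad g(z,y)=\tfrac12\langle z,Qz\rangle+\langle q,z\rangle+\iota_{\{Az=y\}}(z,y),$$ where $\iota_D$ is $0$ on $D$ and $+\infty$ elsewhere; minimizing $f+g$ is the problem of minimizing $\tfrac12\langle z,Qz\rangle+\langle q,z\rangle$ over $z\in\mathcal B$ subject to $Az\in\mathcal C$. Write $\operatorname{prox}_h(x)=\operatorname{argmin}_{y}\big(h(y)+\tfrac12\|y-x\|^2\big)$, $\operatorname{dom}h=\{x: h(x)<+\infty\}$, $h^*(u)=\sup_x(\langle x,u\rangle-h(x))$, $P_D$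 for the projection onto a nonempty closed convex set $D$, $\operatorname{rec}D=\{x: x+y\in D\ \forall y\in D\}$, $D^\circ=\{u:\langle x,u\rangle\le 0\ \forall x\in D\}$, and $\sigma_D(u)=\sup_{x\in D}\langle x,u\rangle$. For $s_0\in\mathcal H$, the Douglas–Rachford iterates are $$x_n=\operatorname{prox}_f s_n,\quad \nu_n=s_n-x_n,\quad \tilde x_n=\operatorname{prox}_g(2x_n-s_n),\quad s_{n+1}=s_n+\tilde x_n-x_n,$$ that is, $s_n=T^ns_0$ with $T=\tfrac12\mathrm{Id}+\tfrac12(2\operatorname{prox}_g-\mathrm{Id})(2\operatorname{prox}_f-\mathrm{Id})$; write $x_n=(z_n,y_n)$ and $\nu_n=(\lambda_n,\mu_n)$. Define $$v=P_{\overline{\operatorname{ran}}(\mathrm{Id}-T)}(0),\qquad v_p=P_{\overline{\operatorname{dom}f-\operatorname{dom}g}}(0),\qquad v_d=P_{\overline{\operatorname{dom}f^*+\operatorname{dom}g^*}}(0),$$ with components $v=(v',v'')$, $v_p=(v_p',v_p'')$, $v_d=(v_d',v_d'')$ in $\mathcal H_1\times\mathcal H_2$. Then, for every $s_0\in\mathcal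 H$: 1. $(-v_d',-v_d'')=\big(P_{\operatorname{rec}\mathcal B}(-v'),\,P_{\operatorname{rec}\mathcal C}(-v'')\big)$. 2. $(-v_p',-v_p'')=\big(P_{(\operatorname{rec}\mathcal B)^\circ}(-v'),\,P_{(\operatorname{rec}\mathcal C)^\circ}(-v'')\big)$. 3. $(z_n-z_{n+1},\,y_n-y_{n+1},\,\lambda_n-\lambda_{n+1},\,\mu_n-\mu_{n+1})\to(v_d',v_d'',v_p',v_p'')$ as $n\to\infty$. 4. $Qv_d'=0$. 5. $Av_d'=v_d''$. 6. $\langle q,-v_d'\rangle=-\|v_d\|^2$. 7. $v_p'+A^*v_p''=0$, where $A^*$ is the adjoint of $A$. 8. $\sigma_{\mathcal B}(-v_p')+\sigma_{\mathcal C}(-v_p'')=-\|v_p\|^2$. -/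

import Mathlib

open Filter
open scoped Topology Pointwise

noncomputable section

namespace DouglasRachford

section General

variable {H : Type*} [NormedAddCommGroup H] [InnerProductSpace ℝ H]

/-- The effective domain of an extended-real-valued function. -/
def effDom (f : H → EReal) : Set H := {x | f x < ⊤}

/-- The Fenchel conjugate `f*(u) = sup_x (⟪x, u⟫ - f x)`. -/
def fenchelConj (f : H → EReal) (u : H) : EReal :=
  ⨆ x : H, (((inner ℝ x u : ℝ) : EReal) - f x)

open Classical in
/-- The indicator function of convex analysis: `0` on `C` and `+∞` off `C`. -/
def indicatorFn (C : Set H) (x : H) : EReal := if x ∈ C then 0 else ⊤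

/-- The support function `σ_C(u) = sup_{x ∈ C} ⟪x, u⟫`. -/
def supportFn (C : Set H) (u : H) : EReal :=
  ⨆ x ∈ C, ((inner ℝ x u : ℝ) : EReal)

/-- The polar cone of `C`. -/
def polarCone (C : Set H) : Set H := {u | ∀ x ∈ C, inner ℝ x u ≤ 0}

/-- The recession cone of `C`. -/
def recessionCone (C : Set H) : Set H := {x | ∀ y ∈ C, x + y ∈ C}

/-- `p` is a point of `C` nearest to `x`. -/
def IsProj (C : Set H) (x p : H) : Prop := p ∈ C ∧ ∀ y ∈ C, ‖p - x‖ ≤ ‖y - x‖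

/-- The projection operator onto `C` (meaningful for nonempty closed convex `C`). -/
def proj (C : Set H) (x : H) : H := Classical.epsilon (IsProj C x)

/-- `p` minimizes `y ↦ f y + ½ ‖y - x‖²` over the whole space. -/
def IsProx (f : H → EReal) (x p : H) : Prop :=
  ∀ y : H, f p + ((1 / 2 * ‖p - x‖ ^ 2 : ℝ) : EReal) ≤ f y + ((1 / 2 * ‖y - x‖ ^ 2 : ℝ) : EReal)

/-- The proximity operator of `f` (meaningful for proper lower semicontinuous convex `f`). -/
def prox (f : H → EReal) (x : H) : H := Classical.epsilon (IsProx f x)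

/-- The Douglas-Rachford operator `T = ½ Id + ½ (2 prox_g - Id) ∘ (2 prox_f - Id)`. -/
def drOp (f g : H → EReal) (s : H) : H :=
  (1 / 2 : ℝ) • s
    + (1 / 2 : ℝ) • ((2 : ℝ) • prox g ((2 : ℝ) • prox f s - s) - ((2 : ℝ) • prox f s - s))

/-- The governing sequence: `s_{n+1} = s_n + prox_g (2 x_n - s_n) - x_n` with `x_n = prox_f s_n`. -/
def drS (f g : H → EReal) (s₀ : H) : ℕ → H
  | 0 => s₀
  | n + 1 =>
    drS f g s₀ n + prox g ((2 : ℝ) • prox f (drS f g s₀ n) - drS f g s₀ n)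
      - prox f (drS f g s₀ n)

/-- The shadow sequence `x_n = prox_f s_n`. -/
def drX (f g : H → EReal) (s₀ : H) (n : ℕ) : H := prox f (drS f g s₀ n)

/-- The dual sequence `ν_n = s_n - x_n`. -/
def drNu (f g : H → EReal) (s₀ : H) (n : ℕ) : H := drS f g s₀ n - drX f g s₀ n

/-- The minimal displacement vector `v` of `T`: the projection of `0` onto
the closure of the range of `Id - T`. -/
def minDispl (f g : H → EReal) : H :=
  proj (closure (Set.range fun s : H => s - drOp f g s)) 0

/-- The vector `v_p`: the projection of `0` onto the closure of `dom f - dom g`. -/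
def primalDispl (f g : H → EReal) : H := proj (closure (effDom f - effDom g)) 0

/-- The vector `v_d`: the projection of `0` onto the closure of `dom f* + dom g*`. -/
def dualDispl (f g : H → EReal) : H :=
  proj (closure (effDom (fenchelConj f) + effDom (fenchelConj g))) 0

/-- In finite dimension the projection onto a nonempty closed set is attained. -/
theorem isProj_proj [FiniteDimensional ℝ H] {C : Set H} (hne : C.Nonempty) (hcl : IsClosed C)
    (x : H) : IsProj C x (proj C x) := by
  haveI : ProperSpace H := FiniteDimensional.proper ℝ H
  obtain ⟨p, hp, h⟩ := hcl.exists_infDist_eq_dist hne x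
  refine Classical.epsilon_spec (p := IsProj C x) ⟨p, hp, fun y hy => ?_⟩
  rw [← dist_eq_norm, ← dist_eq_norm, dist_comm p, dist_comm y, ← h]
  exact Metric.infDist_le_dist_of_mem hy

/-- The recursion that defines the governing sequence is the iteration of `T`. -/
theorem drS_succ (f g : H → EReal) (s₀ : H) (n : ℕ) :
    drS f g s₀ (n + 1) = drOp f g (drS f g s₀ n) := by
  simp only [drS, drOp]
  module

end General

section Quadratic

variable {H₁ H₂ : Type*} [NormedAddCommGroup H₁] [InnerProductSpace ℝ H₁]
  [NormedAddCommGroup H₂] [InnerProductSpace ℝ H₂]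

/-- `f(z, y) = ι_B(z) + ι_C(y)` on the Hilbert space product `H₁ × H₂`. -/
def quadF (B : Set H₁) (C : Set H₂) (w : WithLp 2 (H₁ × H₂)) : EReal :=
  indicatorFn B w.fst + indicatorFn C w.snd

/-- `g(z, y) = ½ ⟪z, Q z⟫ + ⟪q, z⟫ + ι_{A z = y}(z, y)` on the Hilbert space product `H₁ × H₂`. -/
def quadG (Q : H₁ →ₗ[ℝ] H₁) (q : H₁) (A : H₁ →ₗ[ℝ] H₂) (w : WithLp 2 (H₁ × H₂)) : EReal :=
  ((1 / 2 * inner ℝ w.fst (Q w.fst) + inner ℝ q w.fst : ℝ) : EReal)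
    + indicatorFn {w' : WithLp 2 (H₁ × H₂) | A w'.fst = w'.snd} w

end Quadratic

end DouglasRachford

end

open DouglasRachford

/-!
The problem is treated on one space `H`, with `f` the indicator function of a closed convex set `D`
and `g` a convex quadratic function restricted to a subspace `G`; in the application `D` is `B × C`
and `G` is the graph of `A`.

The optimality conditions of the two nearest-point problems give `v_p ∈ Gᗮ`, `v_d ∈ G`, `S v_d = 0`
for the Hessian `S`, `⟪c, v_d⟫ = ‖v_d‖²` for the linear term `c`, `σ_D (-v_p) = -‖v_p‖²`,
`-v_p ∈ (rec D)°` and `-v_d ∈ rec D`. In particular `⟪v_p, v_d⟫ = 0`, so the claims about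
projections onto `rec D` and its polar cone are Moreau's decomposition, once `v = v_p + v_d` is
known.

To see that `v = v_p + v_d`, note that every displacement `s - T s` equals `x - x̃` and also the sum
of a subgradient of `f` and one of `g`, so it lies in `(dom f - dom g) ∩ (dom f* + dom g*)`; hence
`⟪v_p + v_d, s - T s⟫ ≥ ‖v_p + v_d‖²`. Conversely, that intersection is contained in the closure of
the range of `Id - T` (`mem_closure_range_sub_drOp`), by the argument of Brezis and Haraux: for `r`
in the intersection, the solutions `s` of `s - T s + ε s = r` satisfy `ε s → 0`. The vector
`v_p + v_d` is in the closure of the intersection because the first set is a union of translates of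
`G` and the second one of translates of `Gᗮ`, so that the components in `Gᗮ` and in `G` can be
approximated independently (`primalDispl_add_dualDispl_isMinimal`).

As `T` is firmly nonexpansive, `s_n - s_{n+1} → v` (`tendsto_iterate_sub_iterate_succ`). This limit
is shared between `x_n - x_{n+1}` and `ν_n - ν_{n+1}`, whose inner product is nonnegative by
monotonicity. The former is asymptotically orthogonal to `v_p`, being close to a difference of
points of `G`, and the latter to `v_d`, being close to a difference of elements of `dom g*`, on
which the functional `⟪·, v_d⟫` is constant. Expanding squares then forces the two limits to be
`v_d` and `v_p` (`tendsto_drX_sub_and_drNu_sub`).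
-/

namespace DouglasRachford

/-! ### Projections, polar cones and support functions -/

section Convex

variable {H : Type*} [NormedAddCommGroup H] [InnerProductSpace ℝ H]

theorem isProj_of_inner_le_zero {K : Set H} {x p : H} (hp : p ∈ K)
    (h : ∀ y ∈ K, inner ℝ (y - p) (x - p) ≤ 0) : IsProj K x p := by
  refine ⟨hp, fun y hy => ?_⟩
  have e : ‖y - x‖ ^ 2 = ‖y - p‖ ^ 2 - 2 * inner ℝ (y - p) (x - p) + ‖p - x‖ ^ 2 := by
    rw [← norm_sub_rev x p, ← norm_sub_sq_real]
    congr 2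
    abel
  have := h y hy
  refine le_of_sq_le_sq ?_ (norm_nonneg _)
  nlinarith [sq_nonneg ‖y - p‖]

theorem IsProj.inner_le_zero {K : Set H} (hK : Convex ℝ K) {x p : H} (hp : IsProj K x p)
    {y : H} (hy : y ∈ K) : inner ℝ (y - p) (x - p) ≤ 0 := by
  have h : ‖x - p‖ = ⨅ w : K, ‖x - w‖ := by
    have : Nonempty K := ⟨⟨p, hp.1⟩⟩
    refine le_antisymm (le_ciInf fun w => ?_) ?_
    · rw [norm_sub_rev x p, norm_sub_rev x w]
      exact hp.2 w w.2
    · exact ciInf_le (f := fun w : K => ‖x - w‖)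
        ⟨0, by rintro _ ⟨w, rfl⟩; exact norm_nonneg _⟩ ⟨p, hp.1⟩
  rw [real_inner_comm]
  exact (norm_eq_iInf_iff_real_inner_le_zero hK hp.1).1 h y hy

theorem le_inner_of_mem_closure {K : Set H} {v w : H} {a : ℝ} (h : ∀ y ∈ K, a ≤ inner ℝ v y)
    (hw : w ∈ closure K) : a ≤ inner ℝ v w :=
  closure_minimal (t := {y | a ≤ inner ℝ v y}) h
    (isClosed_le continuous_const (by fun_prop)) hw

theorem proj_closure_zero_mem [FiniteDimensional ℝ H] {K : Set H} (hne : K.Nonempty) :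
    proj (closure K) 0 ∈ closure K :=
  (isProj_proj hne.closure isClosed_closure 0).1

theorem norm_sq_proj_le_inner [FiniteDimensional ℝ H] {K : Set H} (hne : K.Nonempty)
    (hK : Convex ℝ K) {y : H} (hy : y ∈ K) :
    ‖proj (closure K) 0‖ ^ 2 ≤ inner ℝ (proj (closure K) 0) y := by
  have h := (isProj_proj hne.closure isClosed_closure (0 : H)).inner_le_zero hK.closure
    (subset_closure hy)
  rw [zero_sub, inner_neg_right, inner_sub_left, real_inner_self_eq_norm_sq,
    real_inner_comm] at h
  linarith

theorem proj_closure_zero_eq {K : Set H} {w : H} (hw : w ∈ closure K)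
    (h : ∀ y ∈ K, ‖w‖ ^ 2 ≤ inner ℝ w y) : proj (closure K) 0 = w := by
  have hproj : IsProj (closure K) 0 w := by
    refine isProj_of_inner_le_zero hw fun y hy => ?_
    have := le_inner_of_mem_closure h hy
    rw [zero_sub, inner_neg_right, inner_sub_left, real_inner_self_eq_norm_sq, real_inner_comm]
    linarith
  have hp : IsProj (closure K) 0 (proj (closure K) 0) :=
    Classical.epsilon_spec (p := IsProj (closure K) 0) ⟨w, hproj⟩
  have h1 := le_inner_of_mem_closure h hp.1
  have h2 := hp.2 w hw
  rw [sub_zero, sub_zero] at h2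
  have h3 : ‖proj (closure K) 0 - w‖ ^ 2 = 0 := by
    refine le_antisymm ?_ (sq_nonneg _)
    rw [norm_sub_sq_real, real_inner_comm]
    nlinarith [norm_nonneg (proj (closure K) 0)]
  exact sub_eq_zero.1 (norm_eq_zero.1 ((pow_eq_zero_iff two_ne_zero).1 h3))

/-- A lower bound on the whole affine line `t ↦ b + t * k` forces it to be constant. -/
theorem eq_zero_of_forall_le_add_mul {a b k : ℝ} (h : ∀ t : ℝ, a ≤ b + t * k) : k = 0 := by
  by_contra hk
  have := h ((a - b - 1) / k)
  rw [div_mul_cancel₀ _ hk] at this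
  linarith

theorem nonneg_of_forall_le_add_natCast_mul {a b k : ℝ} (h : ∀ n : ℕ, a ≤ b + n * k) :
    0 ≤ k := by
  by_contra! hk
  obtain ⟨n, hn⟩ := exists_nat_gt ((b - a) / -k)
  rw [div_lt_iff₀ (by linarith)] at hn
  linarith [h n]

/-- Moreau's decomposition, for a cone `K` and its polar cone. -/
theorem isProj_polarCone {K : Set H} {p u : H} (hp : p ∈ K) (hu : u ∈ polarCone K)
    (hpu : inner ℝ p u = 0) :
    IsProj K (p + u) p ∧ IsProj (polarCone K) (p + u) u := by
  constructor
  · refine isProj_of_inner_le_zero hp fun y hy => ?_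
    rw [add_sub_cancel_left, inner_sub_left, hpu, sub_zero]
    exact hu y hy
  · refine isProj_of_inner_le_zero hu fun y hy => ?_
    rw [add_sub_cancel_right, inner_sub_left, real_inner_comm, real_inner_comm p u, hpu, sub_zero]
    exact hy p hp

/-- A least upper bound in `ℝ` remains one in the extended reals. -/
theorem supportFn_eq_coe {K : Set H} {u : H} {β : ℝ}
    (h : IsLUB ((fun x => inner ℝ x u) '' K) β) : supportFn K u = (β : EReal) := by
  refine le_antisymm (iSup₂_le fun x hx => EReal.coe_le_coe_iff.2 (h.1 ⟨x, hx, rfl⟩)) ?_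
  refine le_of_forall_lt fun a ha => ?_
  obtain ⟨r, har, hr⟩ := EReal.lt_iff_exists_real_btwn.1 ha
  obtain ⟨_, ⟨x, hx, rfl⟩, hrx, -⟩ := h.exists_between (EReal.coe_lt_coe_iff.1 hr)
  exact (har.trans (EReal.coe_lt_coe_iff.2 hrx)).trans_le
    (le_iSup₂ (f := fun x (_ : x ∈ K) => ((inner ℝ x u : ℝ) : EReal)) x hx)

end Convex

/-! ### Subgradients, conjugates and proximity operators -/

section ExtendTop

variable {H : Type*}

open Classical in
/-- The extended-real-valued function that is `φ` on `K` and `+∞` off `K`. Every function that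
omits the value `-∞` has this form, and this form lets the arithmetic take place in `ℝ`. -/
noncomputable def extendTop (K : Set H) (φ : H → ℝ) (x : H) : EReal :=
  if x ∈ K then (φ x : EReal) else ⊤

variable {K : Set H} {φ : H → ℝ}

theorem extendTop_of_mem {x : H} (hx : x ∈ K) : extendTop K φ x = φ x := if_pos hx

theorem extendTop_of_notMem {x : H} (hx : x ∉ K) : extendTop K φ x = ⊤ := if_neg hx

theorem effDom_extendTop : effDom (extendTop K φ) = K := by
  ext x
  by_cases hx : x ∈ K <;> simp [effDom, extendTop, hx]

end ExtendTop

section Subgradient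

variable {H : Type*} [NormedAddCommGroup H] [InnerProductSpace ℝ H]

/-- `u` is a subgradient at `x` of the function that is `φ` on `K` and `+∞` off `K`. -/
def IsSubgradient (K : Set H) (φ : H → ℝ) (x u : H) : Prop :=
  x ∈ K ∧ ∀ y ∈ K, φ x + inner ℝ (y - x) u ≤ φ y

variable {K : Set H} {φ : H → ℝ}

theorem mem_effDom_fenchelConj_iff {u : H} :
    u ∈ effDom (fenchelConj (extendTop K φ)) ↔ ∃ M : ℝ, ∀ x ∈ K, inner ℝ x u - φ x ≤ M := by
  constructor
  · intro hu
    obtain ⟨M, hM, -⟩ := EReal.lt_iff_exists_real_btwn.1 (show fenchelConj _ u < ⊤ from hu)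
    refine ⟨M, fun x hx => ?_⟩
    have := (le_iSup (fun x : H => ((inner ℝ x u : ℝ) : EReal) - extendTop K φ x) x).trans hM.le
    rw [extendTop_of_mem hx] at this
    exact_mod_cast this
  · rintro ⟨M, hM⟩
    refine lt_of_le_of_lt (iSup_le fun x => ?_) (EReal.coe_lt_top M)
    by_cases hx : x ∈ K
    · rw [extendTop_of_mem hx]
      exact_mod_cast hM x hx
    · simp [extendTop_of_notMem hx]

theorem convex_effDom_fenchelConj : Convex ℝ (effDom (fenchelConj (extendTop K φ))) := by
  intro u hu w hw a b ha hb hab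
  rw [mem_effDom_fenchelConj_iff] at *
  obtain ⟨M, hM⟩ := hu
  obtain ⟨N, hN⟩ := hw
  refine ⟨a * M + b * N, fun x hx => ?_⟩
  rw [inner_add_right, inner_smul_right, inner_smul_right]
  have h1 := mul_le_mul_of_nonneg_left (hM x hx) ha
  have h2 := mul_le_mul_of_nonneg_left (hN x hx) hb
  have h3 : φ x = a * φ x + b * φ x := by rw [← add_mul, hab, one_mul]
  linarith

theorem IsSubgradient.mem_effDom_fenchelConj {x u : H} (h : IsSubgradient K φ x u) :
    u ∈ effDom (fenchelConj (extendTop K φ)) := by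
  refine mem_effDom_fenchelConj_iff.2 ⟨inner ℝ x u - φ x, fun y hy => ?_⟩
  have := h.2 y hy
  rw [inner_sub_left] at this
  linarith

theorem IsSubgradient.inner_nonneg {x u y w : H} (hx : IsSubgradient K φ x u)
    (hy : IsSubgradient K φ y w) : 0 ≤ inner ℝ (x - y) (u - w) := by
  have h1 := hx.2 y hy.1
  have h2 := hy.2 x hx.1
  rw [← neg_sub x y, inner_neg_left] at h1
  rw [inner_sub_right]
  linarith

/-- Subdifferentials are `3*`-monotone: a pair in `dom f × dom f*` need not lie on the graph of
the subdifferential, but it is monotonically related to the graph up to a constant. -/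
theorem exists_forall_le_inner {a b : H} (ha : a ∈ K)
    (hb : b ∈ effDom (fenchelConj (extendTop K φ))) :
    ∃ M : ℝ, ∀ x u, IsSubgradient K φ x u → -M ≤ inner ℝ (x - a) (u - b) := by
  obtain ⟨M, hM⟩ := mem_effDom_fenchelConj_iff.1 hb
  refine ⟨φ a + M - inner ℝ a b, fun x u h => ?_⟩
  have h1 := h.2 a ha
  have h2 := hM x h.1
  rw [← neg_sub x a, inner_neg_left] at h1
  rw [inner_sub_right, inner_sub_left x a b]
  linarith

/-- Optimality condition for the proximity operator. -/
theorem IsSubgradient.prox_eq {s p : H} (h : IsSubgradient K φ p (s - p)) :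
    prox (extendTop K φ) s = p := by
  have key : ∀ y ∈ K, φ p + 1 / 2 * ‖p - s‖ ^ 2 + 1 / 2 * ‖y - p‖ ^ 2
      ≤ φ y + 1 / 2 * ‖y - s‖ ^ 2 := by
    intro y hy
    have e : ‖y - s‖ ^ 2 = ‖y - p‖ ^ 2 - 2 * inner ℝ (y - p) (s - p) + ‖p - s‖ ^ 2 := by
      rw [← norm_sub_rev s p, ← norm_sub_sq_real]
      congr 2
      abel
    have := h.2 y hy
    linarith
  have hprox : IsProx (extendTop K φ) s p := by
    intro y
    by_cases hy : y ∈ K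
    · rw [extendTop_of_mem h.1, extendTop_of_mem hy]
      have := key y hy
      have h0 := sq_nonneg ‖y - p‖
      exact_mod_cast (by linarith : φ p + 1 / 2 * ‖p - s‖ ^ 2 ≤ φ y + 1 / 2 * ‖y - s‖ ^ 2)
    · rw [extendTop_of_notMem hy, EReal.top_add_coe]
      exact le_top
  have hp' : IsProx (extendTop K φ) s (prox (extendTop K φ) s) :=
    Classical.epsilon_spec (p := IsProx (extendTop K φ) s) ⟨p, hprox⟩
  set p' := prox (extendTop K φ) s
  have hle := hp' p
  have hmem : p' ∈ K := by
    by_contra hn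
    rw [extendTop_of_notMem hn, EReal.top_add_coe, extendTop_of_mem h.1, ← EReal.coe_add] at hle
    exact EReal.coe_ne_top _ (top_le_iff.1 hle)
  rw [extendTop_of_mem h.1, extendTop_of_mem hmem, ← EReal.coe_add, ← EReal.coe_add,
    EReal.coe_le_coe_iff] at hle
  have h1 := key p' hmem
  have h2 : ‖p' - p‖ ^ 2 = 0 := le_antisymm (by linarith) (sq_nonneg _)
  exact sub_eq_zero.1 (norm_eq_zero.1 (pow_eq_zero_iff two_ne_zero |>.1 h2))

theorem isSubgradient_prox (hK : ∀ s, ∃ p, IsSubgradient K φ p (s - p)) (s : H) :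
    IsSubgradient K φ (prox (extendTop K φ) s) (s - prox (extendTop K φ) s) := by
  obtain ⟨p, hp⟩ := hK s
  rwa [hp.prox_eq]

end Subgradient

/-! ### Firmly nonexpansive operators -/

section Sequences

variable {H : Type*} [NormedAddCommGroup H]

theorem tendsto_of_tendsto_norm_sq_sub {a : ℕ → H} {w : H}
    (h : Tendsto (fun n => ‖a n - w‖ ^ 2) atTop (𝓝 0)) : Tendsto a atTop (𝓝 w) := by
  rw [tendsto_iff_norm_sub_tendsto_zero]
  simpa [Real.sqrt_sq (norm_nonneg _)] using h.sqrt

theorem antitone_norm_sq_iterate_sub {T : H → H}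
    (hT : ∀ s t, ‖T s - T t‖ ^ 2 + ‖(s - T s) - (t - T t)‖ ^ 2 ≤ ‖s - t‖ ^ 2) (s t : H) :
    Antitone fun n => ‖T^[n] s - T^[n] t‖ ^ 2 := by
  refine antitone_nat_of_succ_le fun n => ?_
  rw [Function.iterate_succ_apply', Function.iterate_succ_apply']
  have := hT (T^[n] s) (T^[n] t)
  linarith [sq_nonneg ‖(T^[n] s - T (T^[n] s)) - (T^[n] t - T (T^[n] t))‖]

theorem tendsto_sub_succ_of_antitone {a : ℕ → ℝ} (ha : Antitone a) (h0 : ∀ n, 0 ≤ a n) :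
    Tendsto (fun n => a n - a (n + 1)) atTop (𝓝 0) := by
  have h := tendsto_atTop_ciInf ha ⟨0, by rintro _ ⟨n, rfl⟩; exact h0 n⟩
  simpa using h.sub (h.comp (tendsto_add_atTop_nat 1))

end Sequences

section FirmlyNonexpansive

variable {H : Type*} [NormedAddCommGroup H] [InnerProductSpace ℝ H]

/-- If, for some `y`, the pair `(y, w)` is monotonically related to the graph of `Id - T` up to a
constant, then `w` lies in the closure of the range of `Id - T`. The approximate preimages are the
solutions `s` of `s - T s + ε s = w`. -/
theorem mem_closure_range_of_forall_le_inner [CompleteSpace H] {T : H → H}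
    (hT : LipschitzWith 1 T) {w y : H} {M : ℝ}
    (h : ∀ s, -M ≤ inner ℝ (s - T s - w) (s - y)) :
    w ∈ closure (Set.range fun s => s - T s) := by
  rw [Metric.mem_closure_iff]
  intro η hη
  obtain ⟨δ, hδ, hδη⟩ : ∃ δ : ℝ, 0 < δ ∧ 2 * δ < η := ⟨η / 3, by positivity, by linarith⟩
  obtain ⟨ε, hε, hεM, hεy⟩ : ∃ ε : ℝ, 0 < ε ∧ ε * |M| ≤ δ ^ 2 ∧ ε * ‖y‖ ≤ δ := by
    refine ⟨min (δ ^ 2 / (|M| + 1)) (δ / (‖y‖ + 1)), by positivity, ?_, ?_⟩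
    · calc _ ≤ δ ^ 2 / (|M| + 1) * (|M| + 1) := by
            gcongr
            · exact min_le_left _ _
            · linarith
        _ = δ ^ 2 := div_mul_cancel₀ _ (by positivity)
    · calc _ ≤ δ / (‖y‖ + 1) * (‖y‖ + 1) := by
            gcongr
            · exact min_le_right _ _
            · linarith
        _ = δ := div_mul_cancel₀ _ (by positivity)
  obtain ⟨s, hs⟩ : ∃ s, (1 + ε)⁻¹ • (T s + w) = s := by
    have hlt : (1 + ε)⁻¹ < 1 := inv_lt_one_of_one_lt₀ (by linarith)
    have hc : ContractingWith ⟨(1 + ε)⁻¹, by positivity⟩ fun s => (1 + ε)⁻¹ • (T s + w) := by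
      refine ⟨hlt, LipschitzWith.of_dist_le_mul fun a b => ?_⟩
      rw [dist_smul₀, dist_add_right, Real.norm_of_nonneg (by positivity)]
      have := hT.dist_le_mul a b
      rw [NNReal.coe_one, one_mul] at this
      exact mul_le_mul_of_nonneg_left this (by positivity)
    exact ⟨_, hc.fixedPoint_isFixedPt⟩
  have hs' : s - T s - w = -(ε • s) := by
    have : T s + w = (1 + ε) • s := by
      conv_rhs => rw [← hs]
      rw [smul_inv_smul₀ (by positivity)]
    rw [sub_sub, this]
    module
  refine ⟨_, ⟨s, rfl⟩, ?_⟩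
  have hb := h s
  rw [hs', inner_neg_left, inner_smul_left, inner_sub_right, real_inner_self_eq_norm_sq] at hb
  have hcs := real_inner_le_norm s y
  have hM := le_abs_self M
  simp only [conj_trivial] at hb
  -- The residual `‖s - T s - w‖ = ε‖s‖` satisfies a quadratic inequality that bounds it by `2δ`.
  have ht : (ε * ‖s‖) ^ 2 ≤ δ ^ 2 + δ * (ε * ‖s‖) := by
    have h1 : ε * ‖s‖ ^ 2 ≤ |M| + ε * (‖s‖ * ‖y‖) := by nlinarith
    have h2 := mul_le_mul_of_nonneg_left h1 hε.le
    have h3 := mul_le_mul_of_nonneg_right hεy (show 0 ≤ ε * ‖s‖ by positivity)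
    nlinarith
  have ht' : ε * ‖s‖ ≤ 2 * δ := by
    have : 0 ≤ ε * ‖s‖ := by positivity
    nlinarith
  rw [dist_comm, dist_eq_norm, hs', norm_neg, norm_smul, Real.norm_of_nonneg hε.le]
  linarith

/-- The successive differences of the iterates of a firmly nonexpansive operator `T` converge to
the element of minimal norm in the closure of the range of `Id - T`. -/
theorem tendsto_iterate_sub_iterate_succ {T : H → H}
    (hT : ∀ s t, ‖T s - T t‖ ^ 2 + ‖(s - T s) - (t - T t)‖ ^ 2 ≤ ‖s - t‖ ^ 2) {w : H}
    (hw : w ∈ closure (Set.range fun s => s - T s))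
    (hle : ∀ s, ‖w‖ ^ 2 ≤ inner ℝ w (s - T s)) (s : H) :
    Tendsto (fun n => T^[n] s - T^[n + 1] s) atTop (𝓝 w) := by
  simp only [Function.iterate_succ_apply']
  have hlow : ∀ n, ‖w‖ ≤ ‖T^[n] s - T (T^[n] s)‖ := fun n => by
    by_contra! hlt
    have h1 := (hle (T^[n] s)).trans (real_inner_le_norm _ _)
    nlinarith [norm_nonneg (T^[n] s - T (T^[n] s))]
  -- The orbit of `s` has asymptotically the same steps as the orbit of any other point `y`, and
  -- the steps of the latter are no longer than the first, `y - T y`, which can be close to `w`.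
  have hnorm : Tendsto (fun n => ‖T^[n] s - T (T^[n] s)‖) atTop (𝓝 ‖w‖) := by
    rw [Metric.tendsto_atTop]
    intro η hη
    obtain ⟨_, ⟨y, rfl⟩, hy⟩ := Metric.mem_closure_iff.1 hw (η / 2) (by positivity)
    have hy' : ‖y - T y‖ < ‖w‖ + η / 2 := by
      rw [dist_eq_norm, norm_sub_rev] at hy
      linarith [norm_sub_norm_le (y - T y) w]
    have hdiff := tendsto_sub_succ_of_antitone (antitone_norm_sq_iterate_sub hT s y)
      fun n => sq_nonneg _
    obtain ⟨N, hN⟩ := eventually_atTop.1 (hdiff.eventually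
      (gt_mem_nhds (show (0 : ℝ) < (η / 2) ^ 2 by positivity)))
    refine ⟨N, fun n hn => ?_⟩
    have h1 := hN n hn
    have h2 := hT (T^[n] s) (T^[n] y)
    rw [Function.iterate_succ_apply', Function.iterate_succ_apply'] at h1
    have h3 : ‖(T^[n] s - T (T^[n] s)) - (T^[n] y - T (T^[n] y))‖ < η / 2 :=
      lt_of_pow_lt_pow_left₀ 2 (by positivity) (by linarith)
    have h4 : ‖T^[n] y - T (T^[n] y)‖ ≤ ‖y - T y‖ := by
      have := antitone_norm_sq_iterate_sub hT y (T y) (Nat.zero_le n)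
      simp only [← Function.iterate_succ_apply, Function.iterate_zero, id_eq] at this
      rw [Function.iterate_succ_apply'] at this
      exact le_of_sq_le_sq this (norm_nonneg _)
    rw [Real.dist_eq, abs_of_nonneg (sub_nonneg.2 (hlow n))]
    linarith [norm_sub_norm_le (T^[n] s - T (T^[n] s)) (T^[n] y - T (T^[n] y))]
  have hsq : Tendsto (fun n => ‖T^[n] s - T (T^[n] s) - w‖ ^ 2) atTop (𝓝 0) := by
    refine squeeze_zero (fun n => sq_nonneg _) (fun n => ?_)
      (show Tendsto (fun n => ‖T^[n] s - T (T^[n] s)‖ ^ 2 - ‖w‖ ^ 2) atTop (𝓝 0) by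
        rw [← sub_self (‖w‖ ^ 2)]
        exact (hnorm.pow 2).sub_const _)
    have := hle (T^[n] s)
    rw [norm_sub_sq_real, real_inner_comm]
    linarith
  exact tendsto_of_tendsto_norm_sq_sub hsq

end FirmlyNonexpansive

/-! ### The Douglas-Rachford operator -/

section Operator

variable {H : Type*} [NormedAddCommGroup H] [InnerProductSpace ℝ H]

theorem sub_drOp (f g : H → EReal) (s : H) :
    s - drOp f g s = prox f s - prox g ((2 : ℝ) • prox f s - s) := by
  rw [drOp]
  module

theorem drS_eq_iterate (f g : H → EReal) (s₀ : H) (n : ℕ) :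
    drS f g s₀ n = (drOp f g)^[n] s₀ := by
  induction n with
  | zero => rfl
  | succ n ih => rw [drS_succ, ih, Function.iterate_succ_apply']

theorem inner_sub_add_of_sub_eq_add {x u x' u' : H} (h : x - x' = u + u') :
    inner ℝ (x - x') (x + u) = ‖x - x'‖ ^ 2 + inner ℝ x u + inner ℝ x' u' := by
  obtain rfl : u' = x - x' - u := by rw [h]; abel
  rw [← real_inner_self_eq_norm_sq]
  simp only [inner_sub_left, inner_sub_right, inner_add_right]
  rw [real_inner_comm x x']
  ring

/-- The point `x̃ = prox_g (2x - s)`, with `x = prox_f s`, of a Douglas-Rachford step from `s`. -/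
noncomputable def drY (f g : H → EReal) (s : H) : H := prox g ((2 : ℝ) • prox f s - s)

/-- The vector `2x - s - x̃`, a subgradient of `g` at the point `x̃` of a Douglas-Rachford step. -/
noncomputable def drW (f g : H → EReal) (s : H) : H := (2 : ℝ) • prox f s - s - drY f g s

theorem sub_drOp_eq_sub (f g : H → EReal) (s : H) :
    s - drOp f g s = prox f s - drY f g s := sub_drOp f g s

theorem sub_drOp_eq_add (f g : H → EReal) (s : H) :
    s - drOp f g s = (s - prox f s) + drW f g s := by
  rw [sub_drOp_eq_sub, drW]
  module

/-- The exact form of firm nonexpansiveness: the defect is the sum of the monotonicity gaps of the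
two subdifferentials. -/
theorem norm_sq_drOp_sub (f g : H → EReal) (s t : H) :
    ‖drOp f g s - drOp f g t‖ ^ 2 + ‖(s - drOp f g s) - (t - drOp f g t)‖ ^ 2
      + 2 * inner ℝ (prox f s - prox f t) ((s - prox f s) - (t - prox f t))
      + 2 * inner ℝ (drY f g s - drY f g t) (drW f g s - drW f g t) = ‖s - t‖ ^ 2 := by
  have h : (prox f s - prox f t) - (drY f g s - drY f g t)
      = ((s - prox f s) - (t - prox f t)) + (drW f g s - drW f g t) := by
    rw [drW, drW]
    module
  have key := inner_sub_add_of_sub_eq_add h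
  have e1 : (prox f s - prox f t) - (drY f g s - drY f g t)
      = (s - drOp f g s) - (t - drOp f g t) := by
    rw [sub_drOp_eq_sub, sub_drOp_eq_sub]
    abel
  have e2 : (prox f s - prox f t) + ((s - prox f s) - (t - prox f t)) = s - t := by abel
  have e3 : drOp f g s - drOp f g t = (s - t) - ((s - drOp f g s) - (t - drOp f g t)) := by abel
  rw [e1, e2, real_inner_comm] at key
  rw [e3, norm_sub_sq_real]
  linarith

variable {K L : Set H} {φ ψ : H → ℝ}

theorem isSubgradient_drY (hL : ∀ s, ∃ p, IsSubgradient L ψ p (s - p)) (f : H → EReal) (s : H) :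
    IsSubgradient L ψ (drY f (extendTop L ψ) s) (drW f (extendTop L ψ) s) :=
  isSubgradient_prox hL _

theorem drOp_firmlyNonexpansive (hK : ∀ s, ∃ p, IsSubgradient K φ p (s - p))
    (hL : ∀ s, ∃ p, IsSubgradient L ψ p (s - p)) (s t : H) :
    ‖drOp (extendTop K φ) (extendTop L ψ) s - drOp (extendTop K φ) (extendTop L ψ) t‖ ^ 2
      + ‖(s - drOp (extendTop K φ) (extendTop L ψ) s)
        - (t - drOp (extendTop K φ) (extendTop L ψ) t)‖ ^ 2 ≤ ‖s - t‖ ^ 2 := by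
  have h := norm_sq_drOp_sub (extendTop K φ) (extendTop L ψ) s t
  have h1 := (isSubgradient_prox hK s).inner_nonneg (isSubgradient_prox hK t)
  have h2 := (isSubgradient_drY hL (extendTop K φ) s).inner_nonneg
    (isSubgradient_drY hL (extendTop K φ) t)
  linarith

/-- A Brezis-Haraux type inclusion for the range of `Id - T`. -/
theorem mem_closure_range_sub_drOp [CompleteSpace H]
    (hK : ∀ s, ∃ p, IsSubgradient K φ p (s - p)) (hL : ∀ s, ∃ p, IsSubgradient L ψ p (s - p))
    {r : H} (h1 : r ∈ K - L)
    (h2 : r ∈ effDom (fenchelConj (extendTop K φ)) + effDom (fenchelConj (extendTop L ψ))) :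
    r ∈ closure (Set.range fun s => s - drOp (extendTop K φ) (extendTop L ψ) s) := by
  obtain ⟨a, ha, b, hb, hab⟩ := h1
  obtain ⟨a', ha', b', hb', hab'⟩ := h2
  obtain ⟨M, hM⟩ := exists_forall_le_inner ha ha'
  obtain ⟨N, hN⟩ := exists_forall_le_inner hb hb'
  have hfirm := drOp_firmlyNonexpansive hK hL
  set f := extendTop K φ
  set g := extendTop L ψ
  have hlip : LipschitzWith 1 (drOp f g) := LipschitzWith.of_dist_le_mul fun s t => by
    rw [NNReal.coe_one, one_mul, dist_eq_norm, dist_eq_norm]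
    refine le_of_sq_le_sq ?_ (norm_nonneg _)
    have := hfirm s t
    linarith [sq_nonneg ‖(s - drOp f g s) - (t - drOp f g t)‖]
  refine mem_closure_range_of_forall_le_inner hlip (y := a + a') (M := M + N) fun s => ?_
  simp only at hab hab'
  have h : (prox f s - a) - (drY f g s - b) = ((s - prox f s) - a') + (drW f g s - b') := by
    have e1 : (prox f s - a) - (drY f g s - b) = (s - drOp f g s) - r := by
      rw [sub_drOp_eq_sub, ← hab]
      abel
    rw [e1, sub_drOp_eq_add, ← hab']
    abel
  have key := inner_sub_add_of_sub_eq_add h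
  have e1 : (prox f s - a) - (drY f g s - b) = s - drOp f g s - r := by
    rw [sub_drOp_eq_sub, ← hab]
    abel
  have e2 : (prox f s - a) + ((s - prox f s) - a') = s - (a + a') := by abel
  rw [e1, e2] at key
  have := hM _ _ (isSubgradient_prox hK s)
  have := hN _ _ (isSubgradient_drY hL f s)
  linarith [sq_nonneg ‖s - drOp f g s - r‖]

theorem sub_drOp_mem_sub (hK : ∀ s, ∃ p, IsSubgradient K φ p (s - p))
    (hL : ∀ s, ∃ p, IsSubgradient L ψ p (s - p)) (s : H) :
    s - drOp (extendTop K φ) (extendTop L ψ) s ∈ K - L :=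
  ⟨_, (isSubgradient_prox hK s).1, _, (isSubgradient_drY hL _ s).1, (sub_drOp_eq_sub _ _ s).symm⟩

theorem sub_drOp_mem_add (hK : ∀ s, ∃ p, IsSubgradient K φ p (s - p))
    (hL : ∀ s, ∃ p, IsSubgradient L ψ p (s - p)) (s : H) :
    s - drOp (extendTop K φ) (extendTop L ψ) s
      ∈ effDom (fenchelConj (extendTop K φ)) + effDom (fenchelConj (extendTop L ψ)) :=
  ⟨_, (isSubgradient_prox hK s).mem_effDom_fenchelConj, _,
    (isSubgradient_drY hL _ s).mem_effDom_fenchelConj, (sub_drOp_eq_add _ _ s).symm⟩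

end Operator

/-! ### Indicator functions, and quadratic functions on a subspace -/

section IndicatorAndQuadratic

variable {H : Type*} [NormedAddCommGroup H] [InnerProductSpace ℝ H]

/-- The quadratic function `w ↦ ½ ⟪w, S w⟫ + ⟪c, w⟫`. -/
noncomputable def quadFn (S : H →ₗ[ℝ] H) (c w : H) : ℝ :=
  1 / 2 * inner ℝ w (S w) + inner ℝ c w

theorem exists_isSubgradient_indicator [FiniteDimensional ℝ H] {D : Set H} (hne : D.Nonempty)
    (hcl : IsClosed D) (hconv : Convex ℝ D) (s : H) :
    ∃ p, IsSubgradient D (fun _ => 0) p (s - p) := by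
  have h := isProj_proj hne hcl s
  exact ⟨_, h.1, fun y hy => by simpa using h.inner_le_zero hconv hy⟩

variable {S : H →ₗ[ℝ] H} {c : H} {G : Submodule ℝ H}

theorem isSubgradient_quadFn (hS : S.IsSymmetric) (hS0 : ∀ z, 0 ≤ inner ℝ z (S z))
    {p u : H} (hp : p ∈ G) (hu : ∀ e ∈ G, inner ℝ e u = inner ℝ e (S p + c)) :
    IsSubgradient (G : Set H) (quadFn S c) p u := by
  refine ⟨hp, fun y hy => ?_⟩
  have h := hS0 (y - p)
  have hsymm : inner ℝ p (S y) = inner ℝ y (S p) := by rw [real_inner_comm, hS]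
  rw [hu _ (G.sub_mem hy hp)]
  simp only [map_sub, inner_sub_left, inner_sub_right, inner_add_right, quadFn] at h ⊢
  rw [real_inner_comm y c, real_inner_comm p c]
  linarith

/-- The optimality condition `p + S p + c - s ∈ Gᗮ` is solvable in `G`, because the compression of
`Id + S` to `G` is positive definite. -/
theorem exists_isSubgradient_quadFn [FiniteDimensional ℝ H] (hS : S.IsSymmetric)
    (hS0 : ∀ z, 0 ≤ inner ℝ z (S z)) (s : H) :
    ∃ p, IsSubgradient (G : Set H) (quadFn S c) p (s - p) := by
  let L : G →ₗ[ℝ] G :=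
    (G.orthogonalProjectionOnto : H →ₗ[ℝ] G) ∘ₗ (LinearMap.id + S) ∘ₗ G.subtype
  have hL : ∀ p e : G, inner ℝ (e : H) (L p : H) = inner ℝ (e : H) ((p : H) + S p) := fun p e => by
    rw [← Submodule.coe_inner]
    exact Submodule.inner_orthogonalProjectionOnto_eq_of_mem_left e _
  have hinj : Function.Injective L := by
    rw [injective_iff_map_eq_zero]
    intro p hp
    have h := hL p p
    rw [hp, Submodule.coe_zero, inner_zero_right, inner_add_right] at h
    have h1 := hS0 (p : H)
    have h2 : inner ℝ (p : H) (p : H) = 0 := le_antisymm (by linarith) real_inner_self_nonneg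
    exact Subtype.ext (inner_self_eq_zero.1 h2)
  obtain ⟨p, hp⟩ := LinearMap.injective_iff_surjective.1 hinj (G.orthogonalProjectionOnto (s - c))
  refine ⟨p, isSubgradient_quadFn hS hS0 p.2 fun e he => ?_⟩
  have h1 := hL p ⟨e, he⟩
  have h2 : inner ℝ e ((G.orthogonalProjectionOnto (s - c) : G) : H) = inner ℝ e (s - c) :=
    Submodule.inner_orthogonalProjectionOnto_eq_of_mem_left (⟨e, he⟩ : G) (s - c)
  rw [hp] at h1
  have h3 := h2.symm.trans h1
  simp only [inner_add_right, inner_sub_right] at h3 ⊢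
  linarith

theorem zero_mem_effDom_fenchelConj_indicator (D : Set H) :
    (0 : H) ∈ effDom (fenchelConj (extendTop D fun _ => 0)) :=
  mem_effDom_fenchelConj_iff.2 ⟨0, fun x _ => by simp⟩

theorem natCast_smul_mem_effDom_fenchelConj_indicator {D : Set H} {u : H}
    (hu : u ∈ effDom (fenchelConj (extendTop D fun _ => 0))) (n : ℕ) :
    (n : ℝ) • u ∈ effDom (fenchelConj (extendTop D fun _ => 0)) := by
  obtain ⟨M, hM⟩ := mem_effDom_fenchelConj_iff.1 hu
  refine mem_effDom_fenchelConj_iff.2 ⟨n * M, fun x hx => ?_⟩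
  have := hM x hx
  rw [sub_zero] at this ⊢
  rw [inner_smul_right]
  exact mul_le_mul_of_nonneg_left this n.cast_nonneg

theorem add_mem_effDom_fenchelConj {ψ : H → ℝ} {b e : H}
    (hb : b ∈ effDom (fenchelConj (extendTop (G : Set H) ψ))) (he : e ∈ Gᗮ) :
    b + e ∈ effDom (fenchelConj (extendTop (G : Set H) ψ)) := by
  obtain ⟨M, hM⟩ := mem_effDom_fenchelConj_iff.1 hb
  refine mem_effDom_fenchelConj_iff.2 ⟨M, fun x hx => ?_⟩
  rw [inner_add_right, (Submodule.mem_orthogonal G e).1 he x hx, add_zero]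
  exact hM x hx

/-- If `g` is linear along `d`, then `⟪·, d⟫` is constant on `dom g*`: otherwise the supremum that
defines the conjugate would be infinite already on the line through `d`. -/
theorem inner_eq_of_mem_effDom_fenchelConj_quadFn {b d : H}
    (hb : b ∈ effDom (fenchelConj (extendTop (G : Set H) (quadFn S c)))) (hd : d ∈ G)
    (hSd : S d = 0) : inner ℝ b d = inner ℝ c d := by
  obtain ⟨M, hM⟩ := mem_effDom_fenchelConj_iff.1 hb
  have h : inner ℝ c d - inner ℝ b d = 0 := by
    refine eq_zero_of_forall_le_add_mul (a := -M) (b := 0) fun t => ?_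
    have := hM (t • d) (G.smul_mem t hd)
    rw [quadFn, map_smul, hSd, smul_zero, inner_zero_right, real_inner_smul_left,
      real_inner_smul_right, real_inner_comm] at this
    linarith
  linarith

theorem mem_effDom_fenchelConj_quadFn (hS : S.IsSymmetric) (hS0 : ∀ z, 0 ≤ inner ℝ z (S z))
    {p e : H} (hp : p ∈ G) (he : e ∈ Gᗮ) :
    S p + c + e ∈ effDom (fenchelConj (extendTop (G : Set H) (quadFn S c))) := by
  refine (isSubgradient_quadFn hS hS0 hp fun x hx => ?_).mem_effDom_fenchelConj
  rw [inner_add_right _ _ e, (Submodule.mem_orthogonal G e).1 he x hx, add_zero]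

theorem nonempty_effDom_fenchelConj_add {D : Set H} (hS : S.IsSymmetric)
    (hS0 : ∀ z, 0 ≤ inner ℝ z (S z)) :
    (effDom (fenchelConj (extendTop D fun _ => 0))
      + effDom (fenchelConj (extendTop (G : Set H) (quadFn S c)))).Nonempty :=
  Set.Nonempty.add ⟨0, zero_mem_effDom_fenchelConj_indicator D⟩
    ⟨_, mem_effDom_fenchelConj_quadFn hS hS0 G.zero_mem Gᗮ.zero_mem⟩

end IndicatorAndQuadratic

/-! ### Primal and dual displacement vectors -/

section Displacement

variable {H : Type*} [NormedAddCommGroup H] [InnerProductSpace ℝ H] [FiniteDimensional ℝ H]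
  {D : Set H} {G : Submodule ℝ H} {φ ψ : H → ℝ} {S : H →ₗ[ℝ] H} {c : H}

theorem primalDispl_mem_closure (hne : D.Nonempty) :
    primalDispl (extendTop D φ) (extendTop (G : Set H) ψ) ∈ closure (D - (G : Set H)) := by
  rw [primalDispl, effDom_extendTop, effDom_extendTop]
  exact proj_closure_zero_mem (hne.sub ⟨0, G.zero_mem⟩)

theorem norm_sq_primalDispl_le (hne : D.Nonempty) (hconv : Convex ℝ D) {k : H}
    (hk : k ∈ D - (G : Set H)) :
    ‖primalDispl (extendTop D φ) (extendTop (G : Set H) ψ)‖ ^ 2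
      ≤ inner ℝ (primalDispl (extendTop D φ) (extendTop (G : Set H) ψ)) k := by
  rw [primalDispl, effDom_extendTop, effDom_extendTop]
  exact norm_sq_proj_le_inner (hne.sub ⟨0, G.zero_mem⟩) (hconv.sub G.convex) hk

theorem primalDispl_mem_orthogonal (hne : D.Nonempty) (hconv : Convex ℝ D) :
    primalDispl (extendTop D φ) (extendTop (G : Set H) ψ) ∈ Gᗮ := by
  obtain ⟨d, hd⟩ := hne
  refine (Submodule.mem_orthogonal' G _).2 fun e he => ?_
  have h := fun t : ℝ => norm_sq_primalDispl_le (φ := φ) (ψ := ψ) ⟨d, hd⟩ hconv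
    (Set.sub_mem_sub hd (G.smul_mem (-t) he))
  simp only [neg_smul, sub_neg_eq_add, inner_add_right, inner_smul_right] at h
  exact eq_zero_of_forall_le_add_mul h

theorem isLUB_inner_neg_primalDispl (hne : D.Nonempty) (hconv : Convex ℝ D) :
    IsLUB ((fun d => inner ℝ d (-primalDispl (extendTop D φ) (extendTop (G : Set H) ψ))) '' D)
      (-‖primalDispl (extendTop D φ) (extendTop (G : Set H) ψ)‖ ^ 2) := by
  have horth := primalDispl_mem_orthogonal (φ := φ) (ψ := ψ) (G := G) hne hconv
  have hmem := primalDispl_mem_closure (φ := φ) (ψ := ψ) (G := G) hne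
  constructor
  · rintro _ ⟨d, hd, rfl⟩
    have := norm_sq_primalDispl_le (φ := φ) (ψ := ψ) hne hconv
      (Set.sub_mem_sub hd G.zero_mem)
    rw [sub_zero, real_inner_comm] at this
    simp only [inner_neg_right]
    linarith
  · intro β hβ
    rw [neg_le, ← real_inner_self_eq_norm_sq]
    refine le_inner_of_mem_closure (fun k hk => ?_) hmem
    obtain ⟨d, hd, e, he, rfl⟩ := hk
    have h1 := hβ ⟨d, hd, rfl⟩
    simp only [inner_neg_right, inner_sub_right] at h1 ⊢
    rw [(Submodule.mem_orthogonal' G _).1 horth e he, real_inner_comm]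
    linarith

theorem neg_primalDispl_mem_polarCone (hne : D.Nonempty) (hconv : Convex ℝ D) :
    -primalDispl (extendTop D φ) (extendTop (G : Set H) ψ) ∈ polarCone (recessionCone D) := by
  intro r hr
  obtain ⟨d, hd⟩ := hne
  have hmem : ∀ n : ℕ, d + (n : ℝ) • r ∈ D := fun n => by
    induction n with
    | zero => simpa using hd
    | succ n ih =>
      have := hr _ ih
      rwa [Nat.cast_succ, add_smul, one_smul, ← add_assoc, add_comm _ r]
  have h := nonneg_of_forall_le_add_natCast_mul fun n => by
    have := norm_sq_primalDispl_le (φ := φ) (ψ := ψ) ⟨d, hd⟩ hconv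
      (Set.sub_mem_sub (hmem n) G.zero_mem)
    rwa [sub_zero, inner_add_right, inner_smul_right] at this
  rw [inner_neg_right, real_inner_comm]
  linarith

theorem norm_sq_dualDispl_le (hS : S.IsSymmetric) (hS0 : ∀ z, 0 ≤ inner ℝ z (S z)) {k : H}
    (hk : k ∈ effDom (fenchelConj (extendTop D fun _ => 0))
      + effDom (fenchelConj (extendTop (G : Set H) (quadFn S c)))) :
    ‖dualDispl (extendTop D fun _ => 0) (extendTop (G : Set H) (quadFn S c))‖ ^ 2
      ≤ inner ℝ (dualDispl (extendTop D fun _ => 0) (extendTop (G : Set H) (quadFn S c))) k :=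
  norm_sq_proj_le_inner (nonempty_effDom_fenchelConj_add hS hS0)
    (convex_effDom_fenchelConj.add convex_effDom_fenchelConj) hk

theorem dualDispl_mem (hS : S.IsSymmetric) (hS0 : ∀ z, 0 ≤ inner ℝ z (S z)) :
    dualDispl (extendTop D fun _ => 0) (extendTop (G : Set H) (quadFn S c)) ∈ G := by
  refine G.orthogonal_orthogonal.le ((Submodule.mem_orthogonal' Gᗮ _).2 fun e he => ?_)
  have h := fun t : ℝ => norm_sq_dualDispl_le (c := c) (G := G) hS hS0
    (Set.add_mem_add (zero_mem_effDom_fenchelConj_indicator D)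
      (mem_effDom_fenchelConj_quadFn hS hS0 G.zero_mem (Gᗮ.smul_mem t he)))
  simp only [← add_assoc, inner_add_right _ _ (_ • e), inner_smul_right] at h
  exact eq_zero_of_forall_le_add_mul h

theorem map_dualDispl_eq_zero (hS : S.IsSymmetric) (hS0 : ∀ z, 0 ≤ inner ℝ z (S z)) :
    S (dualDispl (extendTop D fun _ => 0) (extendTop (G : Set H) (quadFn S c))) = 0 := by
  have hmem := dualDispl_mem (D := D) (c := c) (G := G) hS hS0
  have hle := fun t : ℝ => norm_sq_dualDispl_le (c := c) (G := G) hS hS0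
    (Set.add_mem_add (zero_mem_effDom_fenchelConj_indicator D)
      (mem_effDom_fenchelConj_quadFn hS hS0 (G.smul_mem t hmem) Gᗮ.zero_mem))
  set d := dualDispl (extendTop D fun _ => 0) (extendTop (G : Set H) (quadFn S c))
  have hzero : inner ℝ d (S d) = 0 := by
    refine eq_zero_of_forall_le_add_mul (a := ‖d‖ ^ 2) (b := inner ℝ d c) fun t => ?_
    have := hle t
    rw [zero_add, add_zero, inner_add_right, map_smul, inner_smul_right] at this
    linarith
  -- A vector at which a positive semidefinite form vanishes lies in the kernel.
  have h : ∀ t : ℝ, 0 ≤ inner ℝ (S d) (S (S d)) + t * (2 * ‖S d‖ ^ 2) := fun t => by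
    have := hS0 (S d + t • d)
    simp only [map_add, map_smul, inner_add_left, inner_add_right, inner_smul_left,
      inner_smul_right, hzero, conj_trivial] at this
    rw [← hS d (S d), real_inner_self_eq_norm_sq] at this
    linarith
  have h2 := eq_zero_of_forall_le_add_mul h
  rw [mul_eq_zero, or_iff_right two_ne_zero, pow_eq_zero_iff two_ne_zero, norm_eq_zero] at h2
  exact h2

theorem inner_dualDispl_nonneg (hS : S.IsSymmetric) (hS0 : ∀ z, 0 ≤ inner ℝ z (S z)) {u : H}
    (hu : u ∈ effDom (fenchelConj (extendTop D fun _ => 0))) :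
    0 ≤ inner ℝ (dualDispl (extendTop D fun _ => 0) (extendTop (G : Set H) (quadFn S c))) u := by
  have h := fun n : ℕ => norm_sq_dualDispl_le (c := c) (G := G) hS hS0
    (Set.add_mem_add (natCast_smul_mem_effDom_fenchelConj_indicator hu n)
      (mem_effDom_fenchelConj_quadFn hS hS0 G.zero_mem Gᗮ.zero_mem))
  simp only [add_comm (_ • u), inner_add_right _ _ (_ • u), inner_smul_right] at h
  exact nonneg_of_forall_le_add_natCast_mul h

theorem inner_dualDispl_eq_norm_sq (hS : S.IsSymmetric) (hS0 : ∀ z, 0 ≤ inner ℝ z (S z)) :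
    inner ℝ c (dualDispl (extendTop D fun _ => 0) (extendTop (G : Set H) (quadFn S c)))
      = ‖dualDispl (extendTop D fun _ => 0) (extendTop (G : Set H) (quadFn S c))‖ ^ 2 := by
  have hmem := dualDispl_mem (D := D) (c := c) (G := G) hS hS0
  have hker := map_dualDispl_eq_zero (D := D) (c := c) (G := G) hS hS0
  have hcl : dualDispl (extendTop D fun _ => 0) (extendTop (G : Set H) (quadFn S c)) ∈ closure _ :=
    proj_closure_zero_mem (nonempty_effDom_fenchelConj_add (D := D) (c := c) (G := G) hS hS0)
  refine le_antisymm ?_ ?_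
  · rw [← real_inner_self_eq_norm_sq]
    refine le_inner_of_mem_closure (fun k hk => ?_) hcl
    obtain ⟨u, hu, b, hb, rfl⟩ := hk
    rw [inner_add_right, real_inner_comm b,
      inner_eq_of_mem_effDom_fenchelConj_quadFn hb hmem hker]
    linarith [inner_dualDispl_nonneg (c := c) (G := G) hS hS0 hu]
  · have := norm_sq_dualDispl_le (c := c) (G := G) hS hS0
      (Set.add_mem_add (zero_mem_effDom_fenchelConj_indicator D)
        (mem_effDom_fenchelConj_quadFn hS hS0 G.zero_mem Gᗮ.zero_mem))
    rwa [map_zero, zero_add, zero_add, add_zero, real_inner_comm] at this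

/-- `-v_d` is in the polar cone of `dom f*`, and the polar cone of the domain of the support function
of a closed convex set is its recession cone. -/
theorem neg_dualDispl_mem_recessionCone (hne : D.Nonempty) (hcl : IsClosed D)
    (hconv : Convex ℝ D) (hS : S.IsSymmetric) (hS0 : ∀ z, 0 ≤ inner ℝ z (S z)) :
    -dualDispl (extendTop D fun _ => 0) (extendTop (G : Set H) (quadFn S c))
      ∈ recessionCone D := by
  intro d hd
  have hdual := fun u => inner_dualDispl_nonneg (D := D) (c := c) (G := G) (u := u) hS hS0
  set w := dualDispl (extendTop D fun _ => 0) (extendTop (G : Set H) (quadFn S c))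
  -- The normal `u` of `D` at the projection `p` of `-w + d` would separate this point from `D`.
  obtain ⟨p, hp⟩ := exists_isSubgradient_indicator hne hcl hconv (-w + d)
  have h1 := hdual _ hp.mem_effDom_fenchelConj
  have h2 := hp.2 d hd
  set u := -w + d - p with hu
  have h3 : inner ℝ u u = inner ℝ (d - p) u - inner ℝ w u := by
    rw [← inner_sub_left]
    congr 1
    rw [hu]
    abel
  have h4 : inner ℝ u u = 0 := le_antisymm (by linarith) real_inner_self_nonneg
  rw [sub_eq_zero.1 (inner_self_eq_zero.1 h4 : -w + d - p = 0)]
  exact hp.1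

/-- The sum `v_p + v_d` is the element of minimal norm in the closure of the range of `Id - T`.
Since `v_p ∈ Gᗮ` and `v_d ∈ G`, and since `D - G` is invariant under translations in `G` and
`dom f* + dom g*` under translations in `Gᗮ`, it is a limit of points common to both sets, and
these lie in the closure of the range. -/
theorem primalDispl_add_dualDispl_isMinimal (hne : D.Nonempty) (hcl : IsClosed D)
    (hconv : Convex ℝ D) (hS : S.IsSymmetric) (hS0 : ∀ z, 0 ≤ inner ℝ z (S z)) {vp vd : H}
    (hvp : vp = primalDispl (extendTop D fun _ => 0) (extendTop (G : Set H) (quadFn S c)))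
    (hvd : vd = dualDispl (extendTop D fun _ => 0) (extendTop (G : Set H) (quadFn S c))) :
    vp + vd ∈ closure (Set.range fun s =>
        s - drOp (extendTop D fun _ => 0) (extendTop (G : Set H) (quadFn S c)) s) ∧
      ∀ s, ‖vp + vd‖ ^ 2 ≤ inner ℝ (vp + vd)
        (s - drOp (extendTop D fun _ => 0) (extendTop (G : Set H) (quadFn S c)) s) := by
  have hK := exists_isSubgradient_indicator hne hcl hconv
  have hL := exists_isSubgradient_quadFn (G := G) (c := c) hS hS0
  have hvpG : vp ∈ Gᗮ := hvp ▸ primalDispl_mem_orthogonal hne hconv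
  have hvdG : vd ∈ G := hvd ▸ dualDispl_mem hS hS0
  constructor
  · have hcp : vp ∈ closure (D - (G : Set H)) := hvp ▸ primalDispl_mem_closure hne
    have hcd : vd ∈ closure (effDom (fenchelConj (extendTop D fun _ => 0))
        + effDom (fenchelConj (extendTop (G : Set H) (quadFn S c)))) := hvd ▸ proj_closure_zero_mem
      (nonempty_effDom_fenchelConj_add (D := D) (c := c) (G := G) hS hS0)
    have hv : vp - G.starProjection vp + G.starProjection vd = vp + vd := by
      rw [(Submodule.starProjection_apply_eq_zero_iff G).2 hvpG,
        Submodule.starProjection_eq_self_iff.2 hvdG, sub_zero]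
    rw [← hv, ← closure_closure]
    refine map_mem_closure₂ (f := fun k e => k - G.starProjection k + G.starProjection e)
      (by fun_prop) hcp hcd fun k hk e he => ?_
    refine mem_closure_range_sub_drOp hK hL ?_ ?_
    · obtain ⟨d, hd, b, hb, rfl⟩ := hk
      refine ⟨d, hd, b + G.starProjection (d - b) - G.starProjection e,
        G.sub_mem (G.add_mem hb (G.starProjection_apply_mem _)) (G.starProjection_apply_mem _), ?_⟩
      simp only
      abel
    · obtain ⟨a, ha, b, hb, rfl⟩ := he
      refine ⟨a, ha, b + ((k - G.starProjection k) - (a + b - G.starProjection (a + b))),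
        add_mem_effDom_fenchelConj hb (Gᗮ.sub_mem (G.sub_starProjection_mem_orthogonal _)
          (G.sub_starProjection_mem_orthogonal _)), ?_⟩
      simp only
      abel
  · intro s
    have h1 := norm_sq_primalDispl_le (φ := fun _ => 0) (ψ := quadFn S c) hne hconv
      (sub_drOp_mem_sub hK hL s)
    have h2 := norm_sq_dualDispl_le hS hS0 (sub_drOp_mem_add hK hL s)
    rw [← hvp] at h1
    rw [← hvd] at h2
    rw [norm_add_sq_real, (Submodule.mem_orthogonal' G vp).1 hvpG vd hvdG, inner_add_left]
    linarith

/-- Along the iterations, `x_n - x_{n+1}` is asymptotically in `G` and `ν_n - ν_{n+1}` is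
asymptotically orthogonal to `v_d`. As the sum of these differences tends to `v_p + v_d` and their
inner product is nonnegative, each of them converges to its own component. -/
theorem tendsto_drX_sub_and_drNu_sub (hne : D.Nonempty) (hcl : IsClosed D) (hconv : Convex ℝ D)
    (hS : S.IsSymmetric) (hS0 : ∀ z, 0 ≤ inner ℝ z (S z)) {f g : H → EReal}
    (hf : f = extendTop D fun _ => 0) (hg : g = extendTop (G : Set H) (quadFn S c)) (s₀ : H) :
    Tendsto (fun n => drX f g s₀ n - drX f g s₀ (n + 1)) atTop (𝓝 (dualDispl f g)) ∧
      Tendsto (fun n => drNu f g s₀ n - drNu f g s₀ (n + 1)) atTop (𝓝 (primalDispl f g)) := by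
  subst hf hg
  have hK := exists_isSubgradient_indicator hne hcl hconv
  have hL := exists_isSubgradient_quadFn (G := G) (c := c) hS hS0
  obtain ⟨hw, hle⟩ := primalDispl_add_dualDispl_isMinimal (G := G) (c := c) hne hcl hconv
    hS hS0 rfl rfl
  have hs := tendsto_iterate_sub_iterate_succ (drOp_firmlyNonexpansive hK hL) hw hle s₀
  have hpG := primalDispl_mem_orthogonal (φ := fun _ => 0) (ψ := quadFn S c) (G := G) hne hconv
  have hdG := dualDispl_mem (D := D) (c := c) (G := G) hS hS0
  have hdS := map_dualDispl_eq_zero (D := D) (c := c) (G := G) hS hS0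
  have hY := isSubgradient_drY hL (extendTop D fun _ => 0)
  have hX := isSubgradient_prox hK
  set f : H → EReal := extendTop D fun _ => 0
  set g := extendTop (G : Set H) (quadFn S c)
  set vp := primalDispl f g
  set vd := dualDispl f g
  simp only [← drS_eq_iterate] at hs
  have hr : Tendsto (fun n => (drS f g s₀ n - drS f g s₀ (n + 1))
      - (drS f g s₀ (n + 1) - drS f g s₀ (n + 1 + 1))) atTop (𝓝 0) := by
    simpa using hs.sub (hs.comp (tendsto_add_atTop_nat 1))
  have hbound : ∀ n, ‖drX f g s₀ n - drX f g s₀ (n + 1) - vd‖ ^ 2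
      + ‖drNu f g s₀ n - drNu f g s₀ (n + 1) - vp‖ ^ 2
      ≤ ‖(drS f g s₀ n - drS f g s₀ (n + 1)) - (vp + vd)‖ ^ 2
        + 2 * inner ℝ ((drS f g s₀ n - drS f g s₀ (n + 1))
      - (drS f g s₀ (n + 1) - drS f g s₀ (n + 1 + 1))) (vp + vd) := by
    intro n
    rw [drS_succ f g s₀ (n + 1)]
    set s := drS f g s₀ n
    have hs1 : drS f g s₀ (n + 1) = drOp f g s := drS_succ f g s₀ n
    rw [drX, drX, drNu, drNu, drX, drX, hs1]
    set t := drOp f g s with ht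
    have e1 : (s - t) - (t - drOp f g t)
        = (prox f s - prox f t) - (drY f g s - drY f g t) := by
      rw [ht, sub_drOp_eq_sub, ← ht, sub_drOp_eq_sub]
      abel
    have e2 : (s - t) - (t - drOp f g t)
        = ((s - prox f s) - (t - prox f t)) + (drW f g s - drW f g t) := by
      rw [ht, sub_drOp_eq_add, ← ht, sub_drOp_eq_add]
      abel
    have i1 : inner ℝ ((s - t) - (t - drOp f g t)) vp = inner ℝ (prox f s - prox f t) vp := by
      rw [e1, inner_sub_left, (Submodule.mem_orthogonal G vp).1 hpG _
        (G.sub_mem (hY s).1 (hY t).1), sub_zero]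
    have i2 : inner ℝ ((s - t) - (t - drOp f g t)) vd
        = inner ℝ ((s - prox f s) - (t - prox f t)) vd := by
      rw [e2, inner_add_left, inner_sub_left (drW f g s),
        inner_eq_of_mem_effDom_fenchelConj_quadFn (hY s).mem_effDom_fenchelConj hdG hdS,
        inner_eq_of_mem_effDom_fenchelConj_quadFn (hY t).mem_effDom_fenchelConj hdG hdS,
        sub_self, add_zero]
    have hmono := (hX s).inner_nonneg (hX t)
    have hpd : inner ℝ vp vd = 0 := (Submodule.mem_orthogonal' G vp).1 hpG vd hdG
    rw [inner_add_right, i1, i2]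
    have e3 : s - t = (prox f s - prox f t) + ((s - prox f s) - (t - prox f t)) := by abel
    rw [e3]
    generalize prox f s - prox f t = X at hmono ⊢
    generalize (s - prox f s) - (t - prox f t) = N at hmono ⊢
    rw [ norm_sub_sq_real, norm_sub_sq_real, norm_sub_sq_real, norm_add_sq_real X,
      norm_add_sq_real vp, hpd]
    simp only [inner_add_left, inner_add_right]
    linarith
  have hlim : Tendsto (fun n => ‖(drS f g s₀ n - drS f g s₀ (n + 1)) - (vp + vd)‖ ^ 2
        + 2 * inner ℝ ((drS f g s₀ n - drS f g s₀ (n + 1))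
      - (drS f g s₀ (n + 1) - drS f g s₀ (n + 1 + 1))) (vp + vd)) atTop (𝓝 0) := by
    have h1 := ((hs.sub_const (vp + vd)).norm).pow 2
    have h2 := (hr.inner (𝕜 := ℝ) (tendsto_const_nhds (x := vp + vd))).const_mul 2
    have h3 := h1.add h2
    rwa [sub_self, norm_zero, inner_zero_left, mul_zero, add_zero, zero_pow two_ne_zero] at h3
  constructor
  · refine tendsto_of_tendsto_norm_sq_sub
      (squeeze_zero (fun n => sq_nonneg _) (fun n => ?_) hlim)
    exact le_trans (le_add_of_nonneg_right (sq_nonneg _)) (hbound n)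
  · refine tendsto_of_tendsto_norm_sq_sub
      (squeeze_zero (fun n => sq_nonneg _) (fun n => ?_) hlim)
    exact le_trans (le_add_of_nonneg_left (sq_nonneg _)) (hbound n)

end Displacement

/-! ### The Hilbert space product -/

section ProductSet

variable {H₁ H₂ : Type*}

/-- The product `B × C` as a subset of the Hilbert space product. -/
def prodSet (B : Set H₁) (C : Set H₂) : Set (WithLp 2 (H₁ × H₂)) :=
  {w | w.fst ∈ B ∧ w.snd ∈ C}

theorem quadF_eq_extendTop (B : Set H₁) (C : Set H₂) :
    quadF B C = extendTop (prodSet B C) fun _ => 0 := by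
  funext w
  by_cases h1 : w.fst ∈ B <;> by_cases h2 : w.snd ∈ C <;>
    simp [quadF, indicatorFn, extendTop, prodSet, h1, h2]

variable [NormedAddCommGroup H₁] [NormedAddCommGroup H₂]

theorem isClosed_prodSet {B : Set H₁} {C : Set H₂} (hB : IsClosed B) (hC : IsClosed C) :
    IsClosed (prodSet B C) :=
  (hB.preimage (WithLp.continuous_fst 2 H₁ H₂)).inter (hC.preimage (WithLp.continuous_snd 2 H₁ H₂))

theorem zero_mem_recessionCone (K : Set H₁) :
    (0 : H₁) ∈ recessionCone K := fun y hy => by rwa [zero_add]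

theorem mem_recessionCone_prodSet {B : Set H₁} {C : Set H₂} (hB : B.Nonempty) (hC : C.Nonempty)
    {w : WithLp 2 (H₁ × H₂)} :
    w ∈ recessionCone (prodSet B C) ↔ w.fst ∈ recessionCone B ∧ w.snd ∈ recessionCone C := by
  obtain ⟨b, hb⟩ := hB
  obtain ⟨c, hc⟩ := hC
  constructor
  · intro h
    exact ⟨fun y hy => (h (WithLp.toLp 2 (y, c)) ⟨hy, hc⟩).1,
      fun y hy => (h (WithLp.toLp 2 (b, y)) ⟨hb, hy⟩).2⟩
  · rintro ⟨h1, h2⟩ y hy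
    exact ⟨h1 _ hy.1, h2 _ hy.2⟩

end ProductSet

section Product

variable {H₁ H₂ : Type*} [NormedAddCommGroup H₁] [InnerProductSpace ℝ H₁]
  [NormedAddCommGroup H₂] [InnerProductSpace ℝ H₂]

/-- The operator `(z, y) ↦ (Q z, 0)` on the Hilbert space product. -/
def prodOp (Q : H₁ →ₗ[ℝ] H₁) : WithLp 2 (H₁ × H₂) →ₗ[ℝ] WithLp 2 (H₁ × H₂) where
  toFun w := WithLp.toLp 2 (Q w.fst, 0)
  map_add' a b := WithLp.ofLp_injective 2 (Prod.ext (by simp) (by simp))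
  map_smul' t a := WithLp.ofLp_injective 2 (Prod.ext (by simp) (by simp))

/-- The graph of `A` as a subspace of the Hilbert space product. -/
def graphSubmodule (A : H₁ →ₗ[ℝ] H₂) : Submodule ℝ (WithLp 2 (H₁ × H₂)) where
  carrier := {w | A w.fst = w.snd}
  zero_mem' := by simp
  add_mem' ha hb := by simp_all
  smul_mem' t a ha := by simp_all

theorem quadG_eq_extendTop (Q : H₁ →ₗ[ℝ] H₁) (q : H₁) (A : H₁ →ₗ[ℝ] H₂) :
    quadG Q q A = extendTop (graphSubmodule A : Set (WithLp 2 (H₁ × H₂)))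
      (quadFn (prodOp Q) (WithLp.toLp 2 (q, 0))) := by
  funext w
  have hq : quadFn (prodOp Q) (WithLp.toLp 2 (q, 0)) w
      = 1 / 2 * inner ℝ w.fst (Q w.fst) + inner ℝ q w.fst := by
    simp [quadFn, prodOp, WithLp.prod_inner_apply]
  rw [quadG, extendTop, hq]
  have hG : w ∈ (graphSubmodule A : Set (WithLp 2 (H₁ × H₂))) ↔ A w.fst = w.snd := Iff.rfl
  by_cases h : A w.fst = w.snd
  · simp [indicatorFn, hG, h]
  · simp only [indicatorFn, hG, Set.mem_ofPred_eq, h, if_false, EReal.coe_add_top]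

theorem convex_prodSet {B : Set H₁} {C : Set H₂} (hB : Convex ℝ B) (hC : Convex ℝ C) :
    Convex ℝ (prodSet B C) := fun _ hx _ hy _ _ ha hb hab =>
  ⟨hB hx.1 hy.1 ha hb hab, hC hx.2 hy.2 ha hb hab⟩

theorem mem_polarCone_recessionCone_prodSet {B : Set H₁} {C : Set H₂} (hB : B.Nonempty)
    (hC : C.Nonempty) {w : WithLp 2 (H₁ × H₂)} (hw : w ∈ polarCone (recessionCone (prodSet B C))) :
    w.fst ∈ polarCone (recessionCone B) ∧ w.snd ∈ polarCone (recessionCone C) := by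
  constructor
  · intro x hx
    have := hw (WithLp.toLp 2 (x, 0))
      ((mem_recessionCone_prodSet hB hC).2 ⟨hx, zero_mem_recessionCone C⟩)
    simpa [WithLp.prod_inner_apply] using this
  · intro x hx
    have := hw (WithLp.toLp 2 (0, x))
      ((mem_recessionCone_prodSet hB hC).2 ⟨zero_mem_recessionCone B, hx⟩)
    simpa [WithLp.prod_inner_apply] using this

theorem supportFn_add_supportFn {B : Set H₁} {C : Set H₂} (hB : B.Nonempty) (hC : C.Nonempty)
    {u : WithLp 2 (H₁ × H₂)} {β : ℝ}
    (h : IsLUB ((fun x => inner ℝ x u) '' prodSet B C) β) :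
    supportFn B u.fst + supportFn C u.snd = (β : EReal) := by
  have himage : (fun x => inner ℝ x u) '' prodSet B C
      = (fun x => inner ℝ x u.fst) '' B + (fun x => inner ℝ x u.snd) '' C := by
    ext t
    constructor
    · rintro ⟨w, hw, rfl⟩
      exact ⟨_, ⟨w.fst, hw.1, rfl⟩, _, ⟨w.snd, hw.2, rfl⟩, (WithLp.prod_inner_apply w u).symm⟩
    · rintro ⟨_, ⟨b, hb, rfl⟩, _, ⟨c, hc, rfl⟩, rfl⟩
      exact ⟨WithLp.toLp 2 (b, c), ⟨hb, hc⟩, WithLp.prod_inner_apply _ u⟩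
  rw [himage] at h
  obtain ⟨b, hb⟩ := hB
  obtain ⟨c, hc⟩ := hC
  have hbB : BddAbove ((fun x => inner ℝ x u.fst) '' B) := ⟨β - inner ℝ c u.snd, by
    rintro _ ⟨x, hx, rfl⟩
    exact le_sub_iff_add_le.2 (h.1 (Set.add_mem_add ⟨x, hx, rfl⟩ ⟨c, hc, rfl⟩))⟩
  have hbC : BddAbove ((fun x => inner ℝ x u.snd) '' C) := ⟨β - inner ℝ b u.fst, by
    rintro _ ⟨x, hx, rfl⟩
    exact le_sub_iff_add_le'.2 (h.1 (Set.add_mem_add ⟨b, hb, rfl⟩ ⟨x, hx, rfl⟩))⟩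
  have hnB : ((fun x => inner ℝ x u.fst) '' B).Nonempty := ⟨_, b, hb, rfl⟩
  have hnC : ((fun x => inner ℝ x u.snd) '' C).Nonempty := ⟨_, c, hc, rfl⟩
  rw [supportFn_eq_coe (isLUB_csSup hnB hbB), supportFn_eq_coe (isLUB_csSup hnC hbC),
    ← EReal.coe_add, ← csSup_add hnB hbB hnC hbC, h.csSup_eq (hnB.add hnC)]

end Product

end DouglasRachford

theorem mainTheorem4
    {H₁ H₂ : Type*}
    [NormedAddCommGroup H₁] [InnerProductSpace ℝ H₁] [FiniteDimensional ℝ H₁]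
    [NormedAddCommGroup H₂] [InnerProductSpace ℝ H₂] [FiniteDimensional ℝ H₂]
    (Q : H₁ →ₗ[ℝ] H₁) (hQsymm : Q.IsSymmetric) (hQmono : ∀ z : H₁, 0 ≤ inner ℝ z (Q z))
    (q : H₁) (A : H₁ →ₗ[ℝ] H₂)
    (B : Set H₁) (hBne : B.Nonempty) (hBcl : IsClosed B) (hBconv : Convex ℝ B)
    (C : Set H₂) (hCne : C.Nonempty) (hCcl : IsClosed C) (hCconv : Convex ℝ C)
    (f g : WithLp 2 (H₁ × H₂) → EReal) (hf : f = quadF B C) (hg : g = quadG Q q A)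
    (v vp vd : WithLp 2 (H₁ × H₂))
    (hv : v = minDispl f g) (hvp : vp = primalDispl f g) (hvd : vd = dualDispl f g)
    (s₀ : WithLp 2 (H₁ × H₂)) (z lam : ℕ → H₁) (y mu : ℕ → H₂)
    (hz : ∀ n, z n = (drX f g s₀ n).fst) (hy : ∀ n, y n = (drX f g s₀ n).snd)
    (hlam : ∀ n, lam n = (drNu f g s₀ n).fst) (hmu : ∀ n, mu n = (drNu f g s₀ n).snd) :
    (IsProj (recessionCone B) (-v.fst) (-vd.fst) ∧
      IsProj (recessionCone C) (-v.snd) (-vd.snd)) ∧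
    (IsProj (polarCone (recessionCone B)) (-v.fst) (-vp.fst) ∧
      IsProj (polarCone (recessionCone C)) (-v.snd) (-vp.snd)) ∧
    Tendsto (fun n => (z n - z (n + 1), y n - y (n + 1), lam n - lam (n + 1), mu n - mu (n + 1)))
      atTop (𝓝 (vd.fst, vd.snd, vp.fst, vp.snd)) ∧
    Q vd.fst = 0 ∧
    A vd.fst = vd.snd ∧
    inner ℝ q (-vd.fst) = -‖vd‖ ^ 2 ∧
    vp.fst + LinearMap.adjoint A vp.snd = 0 ∧
    supportFn B (-vp.fst) + supportFn C (-vp.snd) = ((-‖vp‖ ^ 2 : ℝ) : EReal) := by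
  have hDne : (prodSet B C).Nonempty :=
    ⟨WithLp.toLp 2 (hBne.some, hCne.some), hBne.some_mem, hCne.some_mem⟩
  have hDcl := isClosed_prodSet hBcl hCcl
  have hDconv := convex_prodSet hBconv hCconv
  have hS : (prodOp (H₂ := H₂) Q).IsSymmetric := fun a b => by
    simpa [prodOp, WithLp.prod_inner_apply] using hQsymm a.fst b.fst
  have hS0 : ∀ w : WithLp 2 (H₁ × H₂), 0 ≤ inner ℝ w (prodOp Q w) := fun w => by
    simpa [prodOp, WithLp.prod_inner_apply] using hQmono w.fst
  rw [quadF_eq_extendTop] at hf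
  rw [quadG_eq_extendTop] at hg
  have hlim := tendsto_drX_sub_and_drNu_sub hDne hDcl hDconv hS hS0 hf hg s₀
  rw [← hvd, ← hvp] at hlim
  subst hf hg
  have hsum := primalDispl_add_dualDispl_isMinimal hDne hDcl hDconv hS hS0 hvp hvd
  have hv' : v = vp + vd := hv.trans (proj_closure_zero_eq hsum.1 (Set.forall_mem_range.2 hsum.2))
  have hpG : vp ∈ (graphSubmodule A)ᗮ := hvp ▸ primalDispl_mem_orthogonal hDne hDconv
  have hdG : vd ∈ graphSubmodule A := hvd ▸ dualDispl_mem hS hS0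
  have hdS : prodOp Q vd = 0 := hvd ▸ map_dualDispl_eq_zero hS hS0
  have hdc : inner ℝ (WithLp.toLp 2 (q, 0)) vd = ‖vd‖ ^ 2 :=
    hvd ▸ inner_dualDispl_eq_norm_sq hS hS0
  have hlub : IsLUB ((fun d => inner ℝ d (-vp)) '' prodSet B C) (-‖vp‖ ^ 2) :=
    hvp ▸ isLUB_inner_neg_primalDispl hDne hDconv
  obtain ⟨hr1, hr2⟩ := (mem_recessionCone_prodSet hBne hCne).1
    (show -vd ∈ recessionCone (prodSet B C) from
      hvd ▸ neg_dualDispl_mem_recessionCone hDne hDcl hDconv hS hS0)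
  obtain ⟨hp1, hp2⟩ := mem_polarCone_recessionCone_prodSet hBne hCne
    (show -vp ∈ polarCone (recessionCone (prodSet B C)) from
      hvp ▸ neg_primalDispl_mem_polarCone hDne hDconv)
  -- Both components of `⟪v_d, v_p⟫ = 0` are nonpositive, hence both vanish.
  have horth : inner ℝ (-vd).fst (-vp).fst + inner ℝ (-vd).snd (-vp).snd = (0 : ℝ) := by
    have h : inner ℝ (-vd) (-vp) = (0 : ℝ) := by
      rw [inner_neg_neg]
      exact (Submodule.mem_orthogonal _ vp).1 hpG vd hdG
    rwa [WithLp.prod_inner_apply] at h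
  have hn1 := hp1 _ hr1
  have hn2 := hp2 _ hr2
  have h1 := isProj_polarCone hr1 hp1 (by linarith)
  have h2 := isProj_polarCone hr2 hp2 (by linarith)
  have hv1 : (-vd).fst + (-vp).fst = -v.fst := by
    rw [hv', WithLp.neg_fst, WithLp.neg_fst, WithLp.add_fst]
    abel
  have hv2 : (-vd).snd + (-vp).snd = -v.snd := by
    rw [hv', WithLp.neg_snd, WithLp.neg_snd, WithLp.add_snd]
    abel
  rw [hv1] at h1
  rw [hv2] at h2
  refine ⟨⟨h1.1, h2.1⟩, ⟨h1.2, h2.2⟩, ?_, ?_, hdG, ?_, ?_, ?_⟩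
  · have hfst := WithLp.continuous_fst 2 H₁ H₂
    have hsnd := WithLp.continuous_snd 2 H₁ H₂
    simp only [hz, hy, hlam, hmu]
    exact ((hfst.tendsto _).comp hlim.1).prodMk_nhds (((hsnd.tendsto _).comp hlim.1).prodMk_nhds
      (((hfst.tendsto _).comp hlim.2).prodMk_nhds ((hsnd.tendsto _).comp hlim.2)))
  · exact congrArg WithLp.fst hdS
  · rw [WithLp.prod_inner_apply] at hdc
    rw [inner_neg_right, ← hdc]
    simp
  · refine ext_inner_left ℝ fun x => ?_
    have := (Submodule.mem_orthogonal _ vp).1 hpG (WithLp.toLp 2 (x, A x)) rfl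
    rw [WithLp.prod_inner_apply] at this
    rw [inner_add_right, LinearMap.adjoint_inner_right, inner_zero_right]
    exact this
  · have h := supportFn_add_supportFn hBne hCne hlub
    rwa [WithLp.neg_fst, WithLp.neg_snd] at h
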